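/- Let $\pi_1,\pi_2>0$, $\pi_3\in(-\pi_2,\pi_2)$, $n,p\in[1,\infty)$ (real), $A>0$, $\alpha\in(0,1)$ and $\alpha_c=1-\alpha$. Consider the autonomous system $\dot{\mathbf X}=f(\mathbf X)$ on $\mathbb R^3$, with state $\mathbf X=(X,Z,V)$, given by \[ \dot X=V,\qquad \dot Z=A\left(V-\pi_2|Z|^{n-1}Z|V|-\pi_3|Z|^nV\right),\qquad \dot V=-\alpha|X|^{p-1}X-\alpha_c|Z|^{p-1}Z-\pi_1|X|^pV . \] Put $\mathcal V(X,Z,V)=\frac{\alpha}{p+1}|X|^{p+1}+\frac{\alpha_c}{(p+1)A}|Z|^{p+1}+\frac12V^2$, $\mathcal S_{\mathbf Y}=\{\mathbf W\in\mathbb R^3:\mathcal V(\mathbf W)\le\mathcal V(\mathbf Y)\}$ for $\mathbf Y\in\mathbb R^3$, and $\mathcal E=\{(X,-(\alpha/\alpha_c)^{1/p}X,0):X\in\mathbb R\}$. Let $\mathbf X:[0,\infty)\to\mathbb R^3$ be any solution of this system (with arbitrary initial value) and let $\mathbf Y=\mathbf X(0)$. Let $\mathcal O^{+\infty}_{\mathbf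 Y}$ be its positive limit set, that is, the set of all $q\in\mathbb R^3$ for which there is a nondecreasing sequence of positive times $t_k\to\infty$ with $\mathbf X(t_k)\to q$. Then: (i) $\mathcal O^{+\infty}_{\mathbf Y}$ is nonempty and connected; (ii) $\mathcal O^{+\infty}_{\mathbf Y}$ is invariant, that is, every solution on $[0,\infty)$ starting in $\mathcal O^{+\infty}_{\mathbf Y}$ stays in it for all $t\ge0$, and for every $q\in\mathcal O^{+\infty}_{\mathbf Y}$ and $T\ge0$ there is a solution $x:[0,T]\to\mathcal O^{+\infty}_{\mathbf Y}$ with $x(T)=q$; (iii) $\mathbf X(t)$ converges to $\mathcal O^{+\infty}_{\mathbf Y}$ as $t\to\infty$, that is, for every $\varepsilon>0$ there is $T>0$ such that $\inf_{q\in\mathcal O^{+\infty}_{\mathbf Y}}\|\mathbf X(t)-q\|_2<\varepsilon$ for all $t>T$; (iv) $\mathcal O^{+\infty}_{\mathbf Y}\subseteq\mathcal S_{\mathbf Y}\cap\mathcal E$. -/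

import Mathlib

open Filter Topology

noncomputable section

namespace BoucWen

/-- `x` solves the autonomous system `x' = f(x)` on the set (interval) `I`. Only the values of `x`
on `I` matter: derivatives are taken within `I`, hence one-sided at an endpoint. -/
def IsSolutionOn {d : ℕ} (f : EuclideanSpace ℝ (Fin d) → EuclideanSpace ℝ (Fin d)) (I : Set ℝ)
    (x : ℝ → EuclideanSpace ℝ (Fin d)) : Prop :=
  ∀ t ∈ I, HasDerivWithinAt x (f (x t)) I t

/-- Every solution on `[0, ∞)` that starts in `U` stays in `U`. -/
def IsPositivelyInvariant {d : ℕ} (f : EuclideanSpace ℝ (Fin d) → EuclideanSpace ℝ (Fin d))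
    (U : Set (EuclideanSpace ℝ (Fin d))) : Prop :=
  ∀ x : ℝ → EuclideanSpace ℝ (Fin d), IsSolutionOn f (Set.Ici 0) x → x 0 ∈ U →
    ∀ t : ℝ, 0 ≤ t → x t ∈ U

/-- Every point of `U` is reached, after any prescribed time `T ≥ 0`, by a solution
`x : [0, T] → U`. -/
def IsNegativelyInvariant {d : ℕ} (f : EuclideanSpace ℝ (Fin d) → EuclideanSpace ℝ (Fin d))
    (U : Set (EuclideanSpace ℝ (Fin d))) : Prop :=
  ∀ z ∈ U, ∀ T : ℝ, 0 ≤ T → ∃ x : ℝ → EuclideanSpace ℝ (Fin d),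
    IsSolutionOn f (Set.Icc 0 T) x ∧ (∀ t ∈ Set.Icc 0 T, x t ∈ U) ∧ x T = z

/-- Invariance: positive and negative invariance. -/
def IsInvariantSet {d : ℕ} (f : EuclideanSpace ℝ (Fin d) → EuclideanSpace ℝ (Fin d))
    (U : Set (EuclideanSpace ℝ (Fin d))) : Prop :=
  IsPositivelyInvariant f U ∧ IsNegativelyInvariant f U

/-- The positive limit set of the trajectory `x : [0, ∞) → ℝᵈ`: all limits of `x (t k)` along
nondecreasing sequences of positive times `t k → ∞`. -/
def positiveLimitSet {d : ℕ} (x : ℝ → EuclideanSpace ℝ (Fin d)) :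
    Set (EuclideanSpace ℝ (Fin d)) :=
  {q | ∃ t : ℕ → ℝ, Monotone t ∧ (∀ k, 0 < t k) ∧ Tendsto t atTop atTop ∧
    Tendsto (fun k => x (t k)) atTop (𝓝 q)}

/-- The trajectory `x` converges to the set `S`: the Euclidean distance from `x t` to `S` tends
to zero as `t → ∞`. -/
def ConvergesToSet {d : ℕ} (x : ℝ → EuclideanSpace ℝ (Fin d))
    (S : Set (EuclideanSpace ℝ (Fin d))) : Prop :=
  ∀ ε : ℝ, 0 < ε → ∃ T : ℝ, 0 < T ∧ ∀ t : ℝ, T < t → Metric.infDist (x t) S < ε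

/-- The state function of the nondimensionalized Bouc-Wen-Simon-Hunt-Crossley collision model.
The coordinates of the state are `X = x 0`, `Z = x 1`, `V = x 2`, and `α_c = 1 - α`. -/
def stateFunction (π₁ π₂ π₃ n p α A : ℝ) (x : EuclideanSpace ℝ (Fin 3)) :
    EuclideanSpace ℝ (Fin 3) :=
  !₂[x 2,
    A * (x 2 - π₂ * |x 1| ^ (n - 1) * x 1 * |x 2| - π₃ * |x 1| ^ n * x 2),
    -(α * |x 0| ^ (p - 1) * x 0) - (1 - α) * |x 1| ^ (p - 1) * x 1 - π₁ * |x 0| ^ p * x 2]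

/-- The Lyapunov function of the model. -/
def lyapunov (p α A : ℝ) (x : EuclideanSpace ℝ (Fin 3)) : ℝ :=
  1 / (p + 1) * α * |x 0| ^ (p + 1) + 1 / (p + 1) * ((1 - α) / A) * |x 1| ^ (p + 1)
    + 1 / 2 * x 2 ^ 2

/-- The sublevel set of the Lyapunov function determined by the point `y`. -/
def sublevelSet (p α A : ℝ) (y : EuclideanSpace ℝ (Fin 3)) : Set (EuclideanSpace ℝ (Fin 3)) :=
  {x | lyapunov p α A x ≤ lyapunov p α A y}

/-- The equilibrium line `{(X, -(α/α_c)^(1/p) X, 0) : X ∈ ℝ}`. -/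
def equilibriumLine (p α : ℝ) : Set (EuclideanSpace ℝ (Fin 3)) :=
  {x | ∃ X : ℝ, x = !₂[X, -((α / (1 - α)) ^ (1 / p)) * X, 0]}

end BoucWen

end

/-!
The Lyapunov function `𝒱` is coercive and decreases along solutions at the rate
`D = (1 - α) |Z|^(p-1) |Z|^n (π₂ |Z V| + π₃ Z V) + π₁ |X|^p V²`, so every trajectory stays in a
compact sublevel set, where its limit points form a nonempty connected set that attracts it.

By Barbalat's lemma, if a function of the state converges along a bounded trajectory, then its
derivative along the flow vanishes at every limit point. Applied to `𝒱` this gives `X V = 0` on the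
limit set; applied to `X V`, which therefore tends to zero, it gives `V² + X V' = 0`, hence `V = 0`;
applied to `V` it gives `V' = 0`. So every limit point is an equilibrium, and these are exactly the
points of `𝓔`. The vector field is locally Lipschitz, so the solution starting at an equilibrium is
constant and every set of equilibria is invariant.
-/

namespace BoucWen

section ClusterPoints

variable {ι E G : Type*} {l : Filter ι} [TopologicalSpace E] [TopologicalSpace G] {x : ι → E}
  {K : Set E}

theorem tendsto_comp_of_forall_mapClusterPt_eq (hK : IsCompact K) (hxK : ∀ᶠ t in l, x t ∈ K)
    {Φ : E → G} (hΦ : Continuous Φ) {b : G} (h : ∀ q, MapClusterPt q l x → Φ q = b) :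
    Tendsto (fun t => Φ (x t)) l (𝓝 b) := by
  have hx : Tendsto x l (𝓝ˢ {q | MapClusterPt q l x}) :=
    hK.tendsto_nhdsSet_of_mapClusterPt hxK fun _ _ hq => hq
  have hΦb : Tendsto Φ (𝓝ˢ {q | MapClusterPt q l x}) (𝓝ˢ {b}) := hΦ.tendsto_nhdsSet h
  rw [nhdsSet_singleton] at hΦb
  exact hΦb.comp hx

theorem eq_of_mapClusterPt_of_tendsto_comp [T2Space G] {Φ : E → G} {q : E} {b : G}
    (hΦ : ContinuousAt Φ q) (h : Tendsto (fun t => Φ (x t)) l (𝓝 b)) (hq : MapClusterPt q l x) :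
    Φ q = b := by
  have hΦq : MapClusterPt (Φ q) l (Φ ∘ x) := hq.continuousAt_comp hΦ
  have : (𝓝 (Φ q) ⊓ 𝓝 b).NeBot := hΦq.neBot.mono (inf_le_inf_left _ h)
  exact eq_of_nhds_neBot this

theorem notMem_of_mapClusterPt_of_eventually_mem_disjoint {U V : Set E} (hV : IsOpen V)
    (hUV : Disjoint U V) (hxU : ∀ᶠ t in l, x t ∈ U) {q : E} (hq : MapClusterPt q l x) : q ∉ V := by
  intro hqV
  obtain ⟨t, htV, htU⟩ := ((hq.frequently (hV.mem_nhds hqV)).and_eventually hxU).exists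
  exact hUV.notMem_of_mem_left htU htV

theorem isPreconnected_setOf_mapClusterPt [ConditionallyCompleteLinearOrder ι] [TopologicalSpace ι]
    [OrderTopology ι] [DenselyOrdered ι] [T2Space E] {a : ι} (hx : ContinuousOn x (Set.Ici a))
    (hK : IsCompact K) (hxK : ∀ᶠ t in atTop, x t ∈ K) :
    IsPreconnected {q | MapClusterPt q atTop x} := by
  set C := {q | MapClusterPt q atTop x}
  have hCclosed : IsClosed C := isClosed_setOfPred_clusterPt
  have hCK : C ⊆ K := fun q hq => hK.isClosed.mem_of_mapClusterPt hq hxK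
  have hC : IsCompact C := hK.of_isClosed_subset hCclosed hCK
  rw [isPreconnected_iff_subset_of_fully_disjoint_closed hCclosed]
  intro u v hu hv hCuv huv
  obtain ⟨U, V, hU, hV, huU, hvV, hUV⟩ := SeparatedNhds.of_isCompact_isCompact
    (hC.inter_right hu) (hC.inter_right hv) (huv.mono Set.inter_subset_right Set.inter_subset_right)
  have hCUV : C ⊆ U ∪ V := fun q hq =>
    (hCuv hq).imp (fun hqu => huU ⟨hq, hqu⟩) fun hqv => hvV ⟨hq, hqv⟩
  have hxUV : ∀ᶠ t in atTop, x t ∈ U ∪ V :=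
    (hK.tendsto_nhdsSet_of_mapClusterPt hxK fun _ _ hq => hq).eventually
      ((hU.union hV).mem_nhdsSet.2 hCUV)
  have : Nonempty ι := ⟨a⟩
  obtain ⟨T, hT⟩ := eventually_atTop.1 (hxUV.and (eventually_ge_atTop a))
  have htail : IsPreconnected (x '' Set.Ici T) :=
    isPreconnected_Ici.image x (hx.mono fun t ht => (hT t ht).2)
  rcases htail.subset_or_subset hU hV hUV (Set.image_subset_iff.2 fun t ht => (hT t ht).1)
    with hTU | hTV
  · have hxU : ∀ᶠ t in atTop, x t ∈ U :=
      (eventually_ge_atTop T).mono fun t ht => hTU (Set.mem_image_of_mem x ht)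
    exact Or.inl fun q hq => (hCuv hq).resolve_right fun hqv =>
      notMem_of_mapClusterPt_of_eventually_mem_disjoint hV hUV hxU hq (hvV ⟨hq, hqv⟩)
  · have hxV : ∀ᶠ t in atTop, x t ∈ V :=
      (eventually_ge_atTop T).mono fun t ht => hTV (Set.mem_image_of_mem x ht)
    exact Or.inr fun q hq => (hCuv hq).resolve_left fun hqu =>
      notMem_of_mapClusterPt_of_eventually_mem_disjoint hU hUV.symm hxV hq (huU ⟨hq, hqu⟩)

end ClusterPoints

section Barbalat

variable {E G : Type*} [UniformSpace E] [NormedAddCommGroup G] [NormedSpace ℝ G] {x : ℝ → E}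
  {K : Set E} {a : ℝ}

/-- Barbalat's lemma. -/
theorem tendsto_zero_of_uniformContinuousOn_of_hasDerivWithinAt {φ ψ : ℝ → G} {b : G}
    (hφ : ∀ t ∈ Set.Ici a, HasDerivWithinAt φ (ψ t) (Set.Ici a) t)
    (hψ : UniformContinuousOn ψ (Set.Ici a)) (hb : Tendsto φ atTop (𝓝 b)) :
    Tendsto ψ atTop (𝓝 0) := by
  rw [Metric.tendsto_nhds]
  intro ε hε
  obtain ⟨δ, hδ, hψδ⟩ := Metric.uniformContinuousOn_iff.1 hψ (ε / 2) (half_pos hε)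
  set h := δ / 2 with hh
  have hh0 : 0 < h := half_pos hδ
  have hquot : Tendsto (fun t => h⁻¹ • (φ (t + h) - φ t)) atTop (𝓝 0) := by
    simpa using
      ((hb.comp (tendsto_atTop_add_const_right atTop h tendsto_id)).sub hb).const_smul h⁻¹
  filter_upwards [Metric.tendsto_nhds.1 hquot (ε / 2) (half_pos hε), eventually_ge_atTop a]
    with t hsmall hat
  have hquot_sub : ‖h⁻¹ • (φ (t + h) - φ t) - ψ t‖ ≤ ε / 2 := by
    have hmvt := norm_image_sub_le_of_norm_deriv_le_segment' (a := t) (b := t + h)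
      (f := fun s => φ s - s • ψ t) (f' := fun s => ψ s - (1 : ℝ) • ψ t) (C := ε / 2)
      (fun s hs => ((hφ s (hat.trans hs.1)).mono fun r hr => hat.trans hr.1).sub
        ((hasDerivWithinAt_id s _).smul_const (ψ t)))
      (fun s hs => by
        rw [one_smul, ← dist_eq_norm]
        refine (hψδ s (hat.trans hs.1) t hat ?_).le
        rw [Real.dist_eq, abs_of_nonneg (sub_nonneg.2 hs.1)]
        linarith [hs.2])
      (t + h) (Set.right_mem_Icc.2 (by linarith))
    have hrw : h⁻¹ • (φ (t + h) - φ t) - ψ t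
        = h⁻¹ • (φ (t + h) - (t + h) • ψ t - (φ t - t • ψ t)) := by
      match_scalars <;> field_simp
      ring
    rw [hrw, norm_smul, norm_inv, Real.norm_of_nonneg hh0.le, inv_mul_le_iff₀ hh0]
    linarith
  rw [dist_zero_right] at hsmall ⊢
  linarith [norm_sub_norm_le (ψ t) (h⁻¹ • (φ (t + h) - φ t)),
    norm_sub_rev (ψ t) (h⁻¹ • (φ (t + h) - φ t))]

theorem eq_zero_of_mapClusterPt_of_tendsto_of_hasDerivWithinAt (hK : IsCompact K)
    (hxK : Set.MapsTo x (Set.Ici a) K) (hx : UniformContinuousOn x (Set.Ici a)) {Φ F : E → G}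
    (hF : Continuous F)
    (hΦ : ∀ t ∈ Set.Ici a, HasDerivWithinAt (fun s => Φ (x s)) (F (x t)) (Set.Ici a) t) {b : G}
    (hb : Tendsto (fun t => Φ (x t)) atTop (𝓝 b)) {q : E} (hq : MapClusterPt q atTop x) :
    F q = 0 :=
  have hFx : UniformContinuousOn (fun t => F (x t)) (Set.Ici a) :=
    (hK.uniformContinuousOn_of_continuous hF.continuousOn).comp hx hxK
  eq_of_mapClusterPt_of_tendsto_comp hF.continuousAt
    (tendsto_zero_of_uniformContinuousOn_of_hasDerivWithinAt hΦ hFx hb) hq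

theorem eq_zero_of_mapClusterPt_of_forall_eq_of_hasDerivWithinAt (hK : IsCompact K)
    (hxK : Set.MapsTo x (Set.Ici a) K) (hx : UniformContinuousOn x (Set.Ici a)) {Φ F : E → G}
    (hΦ : Continuous Φ) (hF : Continuous F)
    (hderiv : ∀ t ∈ Set.Ici a, HasDerivWithinAt (fun s => Φ (x s)) (F (x t)) (Set.Ici a) t) {b : G}
    (hb : ∀ q, MapClusterPt q atTop x → Φ q = b) {q : E} (hq : MapClusterPt q atTop x) :
    F q = 0 :=
  eq_zero_of_mapClusterPt_of_tendsto_of_hasDerivWithinAt hK hxK hx hF hderiv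
    (tendsto_comp_of_forall_mapClusterPt_eq hK
      ((eventually_ge_atTop a).mono fun _ ht => hxK ht) hΦ hb) hq

theorem exists_tendsto_of_antitoneOn_Ici {φ : ℝ → ℝ} (hφ : AntitoneOn φ (Set.Ici a))
    (hbdd : BddBelow (φ '' Set.Ici a)) : ∃ b, Tendsto φ atTop (𝓝 b) := by
  have hanti : Antitone fun t => φ (max t a) := fun s t hst =>
    hφ (le_max_right s a) (le_max_right t a) (max_le_max_right a hst)
  have hbdd' : BddBelow (Set.range fun t => φ (max t a)) :=
    hbdd.mono (Set.range_subset_iff.2 fun t => Set.mem_image_of_mem φ (le_max_right t a))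
  refine ⟨_, (tendsto_atTop_ciInf hanti hbdd').congr' ?_⟩
  filter_upwards [eventually_ge_atTop a] with t ht
  rw [max_eq_left ht]

theorem dissipation_eq_zero_of_mapClusterPt (hK : IsCompact K)
    (hxK : Set.MapsTo x (Set.Ici a) K) (hx : UniformContinuousOn x (Set.Ici a)) {Φ D : E → ℝ}
    (hΦ : Continuous Φ) (hD : Continuous D) (hanti : AntitoneOn (fun t => Φ (x t)) (Set.Ici a))
    (hderiv : ∀ t ∈ Set.Ici a, HasDerivWithinAt (fun s => Φ (x s)) (-D (x t)) (Set.Ici a) t)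
    {q : E} (hq : MapClusterPt q atTop x) : D q = 0 := by
  have hbdd : BddBelow ((fun t => Φ (x t)) '' Set.Ici a) :=
    (hK.bddBelow_image hΦ.continuousOn).mono <| by
      rintro _ ⟨t, ht, rfl⟩
      exact Set.mem_image_of_mem Φ (hxK ht)
  obtain ⟨b, hb⟩ := exists_tendsto_of_antitoneOn_Ici hanti hbdd
  exact neg_eq_zero.1 <|
    eq_zero_of_mapClusterPt_of_tendsto_of_hasDerivWithinAt hK hxK hx hD.neg hderiv hb hq

theorem velocity_eq_zero_of_forall_position_mul_velocity_eq_zero (hK : IsCompact K)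
    (hxK : Set.MapsTo x (Set.Ici a) K) (hx : UniformContinuousOn x (Set.Ici a)) {u v w : E → ℝ}
    (hu : Continuous u) (hv : Continuous v) (hw : Continuous w)
    (hux : ∀ t ∈ Set.Ici a, HasDerivWithinAt (fun s => u (x s)) (v (x t)) (Set.Ici a) t)
    (hvx : ∀ t ∈ Set.Ici a, HasDerivWithinAt (fun s => v (x s)) (w (x t)) (Set.Ici a) t)
    (huv : ∀ q, MapClusterPt q atTop x → u q * v q = 0) {q : E} (hq : MapClusterPt q atTop x) :
    v q = 0 := by
  have huv' : v q * v q + u q * w q = 0 :=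
    eq_zero_of_mapClusterPt_of_forall_eq_of_hasDerivWithinAt hK hxK hx (Φ := fun y => u y * v y)
      (F := fun y => v y * v y + u y * w y) (by fun_prop) (by fun_prop)
      (fun t ht => (hux t ht).mul (hvx t ht)) huv hq
  have hcube : v q ^ 3 = 0 := by linear_combination v q * huv' - w q * huv q hq
  exact pow_eq_zero_iff three_ne_zero |>.1 hcube

end Barbalat

section Solutions

variable {d : ℕ} {f : EuclideanSpace ℝ (Fin d) → EuclideanSpace ℝ (Fin d)}
  {x : ℝ → EuclideanSpace ℝ (Fin d)} {I : Set ℝ} {K : Set (EuclideanSpace ℝ (Fin d))}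

theorem mem_positiveLimitSet_iff_mapClusterPt {q : EuclideanSpace ℝ (Fin d)} :
    q ∈ positiveLimitSet x ↔ MapClusterPt q atTop x := by
  refine ⟨fun ⟨t, _, _, ht, htq⟩ => htq.mapClusterPt.of_comp ht, fun hq => ?_⟩
  obtain ⟨t, htq, ht⟩ := hq.exists_seq_tendsto
  obtain ⟨φ, hφ, htφ⟩ := strictMono_subseq_of_tendsto_atTop ht
  have htφ_top : Tendsto (t ∘ φ) atTop atTop := ht.comp hφ.tendsto_atTop
  obtain ⟨N, hN⟩ := eventually_atTop.1 (htφ_top.eventually_gt_atTop 0)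
  have hshift : Tendsto (fun k : ℕ => k + N) atTop atTop := tendsto_add_atTop_nat N
  exact ⟨fun k => t (φ (k + N)), fun _ _ hij => htφ.monotone (Nat.add_le_add_right hij N),
    fun k => hN _ (Nat.le_add_left N k), htφ_top.comp hshift,
    htq.comp (hφ.tendsto_atTop.comp hshift)⟩

theorem positiveLimitSet_eq_setOf_mapClusterPt :
    positiveLimitSet x = {q | MapClusterPt q atTop x} :=
  Set.ext fun _ => mem_positiveLimitSet_iff_mapClusterPt

theorem isConnected_positiveLimitSet (hx : ContinuousOn x (Set.Ici 0)) (hK : IsCompact K)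
    (hxK : ∀ᶠ t in atTop, x t ∈ K) : IsConnected (positiveLimitSet x) := by
  obtain ⟨q, -, hq⟩ := hK.exists_mapClusterPt_of_frequently hxK.frequently
  rw [positiveLimitSet_eq_setOf_mapClusterPt]
  exact ⟨⟨q, hq⟩, isPreconnected_setOf_mapClusterPt hx hK hxK⟩

theorem convergesToSet_positiveLimitSet (hK : IsCompact K) (hxK : ∀ᶠ t in atTop, x t ∈ K) :
    ConvergesToSet x (positiveLimitSet x) := by
  have hdist : Tendsto (fun t => Metric.infDist (x t) (positiveLimitSet x)) atTop (𝓝 0) :=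
    tendsto_comp_of_forall_mapClusterPt_eq hK hxK (Metric.continuous_infDist_pt _) fun _ hq =>
      Metric.infDist_zero_of_mem (mem_positiveLimitSet_iff_mapClusterPt.2 hq)
  intro ε hε
  obtain ⟨T, hT⟩ := eventually_atTop.1 (hdist.eventually_lt_const hε)
  exact ⟨max T 1, by positivity, fun t ht => hT t ((le_max_left T 1).trans ht.le)⟩

theorem IsSolutionOn.continuousOn (hx : IsSolutionOn f I x) : ContinuousOn x I :=
  fun t ht => (hx t ht).continuousWithinAt

theorem IsSolutionOn.hasDerivWithinAt_apply (hx : IsSolutionOn f I x) (i : Fin d) {t : ℝ}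
    (ht : t ∈ I) : HasDerivWithinAt (fun s => x s i) (f (x t) i) I t :=
  (EuclideanSpace.proj (𝕜 := ℝ) i).hasFDerivAt.comp_hasDerivWithinAt t (hx t ht)

theorem IsSolutionOn.uniformContinuousOn (hx : IsSolutionOn f I x) (hI : Convex ℝ I)
    (hf : ContinuousOn f K) (hK : IsCompact K) (hxK : Set.MapsTo x I K) :
    UniformContinuousOn x I := by
  obtain ⟨C, hC⟩ := hK.exists_bound_of_continuousOn hf
  refine (hI.lipschitzOnWith_of_nnnorm_hasDerivWithin_le (C := C.toNNReal) hx
    fun t ht => ?_).uniformContinuousOn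
  rw [← NNReal.coe_le_coe, coe_nnnorm]
  exact (hC _ (hxK ht)).trans (Real.le_coe_toNNReal C)

theorem IsSolutionOn.eq_of_locallyLipschitz_of_eq_zero (hx : IsSolutionOn f (Set.Ici 0) x)
    (hf : LocallyLipschitz f) (h0 : f (x 0) = 0) {t : ℝ} (ht : 0 ≤ t) : x t = x 0 := by
  have hcont : ContinuousOn x (Set.Icc 0 t) := hx.continuousOn.mono fun s hs => hs.1
  obtain ⟨C, hC⟩ := hf.locallyLipschitzOn.exists_lipschitzOnWith_of_compact
    (isCompact_Icc.image_of_continuousOn hcont)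
  refine ODE_solution_unique_of_mem_Icc_right (v := fun _ => f) (f := x) (g := fun _ => x 0)
    (s := fun _ => x '' Set.Icc 0 t) (fun _ _ => hC)
    hcont (fun s hs => (hx s hs.1).mono fun r hr => hs.1.trans hr)
    (fun s hs => ⟨s, ⟨hs.1, hs.2.le⟩, rfl⟩)
    continuousOn_const (fun s _ => ?_) (fun _ _ => ⟨0, Set.left_mem_Icc.2 ht, rfl⟩)
    rfl (Set.right_mem_Icc.2 ht)
  simpa only [h0] using hasDerivWithinAt_const s (Set.Ici s) (x 0)

theorem isInvariantSet_of_forall_eq_zero (hf : LocallyLipschitz f)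
    {U : Set (EuclideanSpace ℝ (Fin d))} (hU : ∀ q ∈ U, f q = 0) : IsInvariantSet f U := by
  refine ⟨fun x hx hx0 t ht => ?_, fun z hz T _ => ⟨fun _ => z, fun t _ => ?_, fun _ _ => hz, rfl⟩⟩
  · rwa [hx.eq_of_locallyLipschitz_of_eq_zero hf (hU _ hx0) ht]
  · simpa only [hU z hz] using hasDerivWithinAt_const t (Set.Icc 0 T) z

end Solutions

section LocallyLipschitz

theorem locallyLipschitz_mul {E R : Type*} [PseudoEMetricSpace E] [NormedRing R]
    [NormedAlgebra ℝ R] {f g : E → R} (hf : LocallyLipschitz f) (hg : LocallyLipschitz g) :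
    LocallyLipschitz fun x => f x * g x :=
  (contDiff_mul (𝕜 := ℝ) (n := 1)).locallyLipschitz.comp (hf.prodMk hg)

theorem locallyLipschitz_of_forall_apply {E ι : Type*} [PseudoEMetricSpace E] [Fintype ι]
    {f : E → EuclideanSpace ℝ ι} (hf : ∀ i, LocallyLipschitz fun x => f x i) :
    LocallyLipschitz f := by
  have hpi : LocallyLipschitz fun x => WithLp.ofLp (f x) := fun x => by
    choose C t ht hC using fun i => hf i x
    refine ⟨Finset.univ.sup C, ⋂ i, t i, Filter.iInter_mem.2 ht, fun y hy z hz => ?_⟩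
    refine edist_pi_le_iff.2 fun i => ?_
    refine (hC i (Set.mem_iInter.1 hy i) (Set.mem_iInter.1 hz i)).trans ?_
    gcongr
    exact Finset.le_sup (Finset.mem_univ i)
  exact (PiLp.lipschitzWith_toLp 2 fun _ : ι => ℝ).locallyLipschitz.comp hpi

theorem locallyLipschitz_abs : LocallyLipschitz fun x : ℝ => |x| :=
  (lipschitzWith_one_norm (E := ℝ)).locallyLipschitz

theorem locallyLipschitz_rpow {m : ℝ} (hm : 1 ≤ m) : LocallyLipschitz fun x : ℝ => x ^ m :=
  (Real.contDiff_rpow_const_of_le (n := 1) (by simpa only [Nat.cast_one] using hm)).locallyLipschitz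

theorem locallyLipschitz_abs_rpow {m : ℝ} (hm : 1 ≤ m) : LocallyLipschitz fun x : ℝ => |x| ^ m :=
  (locallyLipschitz_rpow hm).comp locallyLipschitz_abs

end LocallyLipschitz

section SignedPower

variable {m : ℝ}

/-- The odd power function `x ↦ sign x * |x| ^ m` of a real exponent `m`, in the form in which the
restoring forces of the model are written. -/
noncomputable def signedRpow (m x : ℝ) : ℝ := |x| ^ (m - 1) * x

theorem abs_rpow_sub_one_mul_abs (hm : m ≠ 0) (x : ℝ) : |x| ^ (m - 1) * |x| = |x| ^ m := by
  rcases eq_or_ne x 0 with rfl | hx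
  · rw [abs_zero, mul_zero, Real.zero_rpow hm]
  · rw [← Real.rpow_add_one (abs_ne_zero.2 hx), sub_add_cancel]

theorem abs_signedRpow (hm : m ≠ 0) (x : ℝ) : |signedRpow m x| = |x| ^ m := by
  rw [signedRpow, abs_mul, abs_of_nonneg (Real.rpow_nonneg (abs_nonneg x) _),
    abs_rpow_sub_one_mul_abs hm]

theorem signedRpow_of_nonneg (hm : m ≠ 0) {x : ℝ} (hx : 0 ≤ x) : signedRpow m x = x ^ m := by
  simpa only [signedRpow, abs_of_nonneg hx] using abs_rpow_sub_one_mul_abs hm x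

theorem signedRpow_neg (m x : ℝ) : signedRpow m (-x) = -signedRpow m x := by
  rw [signedRpow, signedRpow, abs_neg, mul_neg]

theorem signedRpow_mul (m x y : ℝ) : signedRpow m (x * y) = signedRpow m x * signedRpow m y := by
  rw [signedRpow, signedRpow, signedRpow, abs_mul, Real.mul_rpow (abs_nonneg x) (abs_nonneg y)]
  ring

theorem signedRpow_one_div_signedRpow (hm : m ≠ 0) (x : ℝ) :
    signedRpow (1 / m) (signedRpow m x) = x := by
  rcases eq_or_ne x 0 with rfl | hx
  · simp only [signedRpow, mul_zero]
  · have hexp : m * (1 / m - 1) + (m - 1) = 0 := by field_simp; ring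
    calc signedRpow (1 / m) (signedRpow m x)
        = (|x| ^ m) ^ (1 / m - 1) * |x| ^ (m - 1) * x := by
          rw [signedRpow, abs_signedRpow hm, signedRpow, mul_assoc]
      _ = |x| ^ (m * (1 / m - 1) + (m - 1)) * x := by
          rw [← Real.rpow_mul (abs_nonneg x), Real.rpow_add (abs_pos.2 hx)]
      _ = x := by rw [hexp, Real.rpow_zero, one_mul]

theorem signedRpow_injective (hm : m ≠ 0) : Function.Injective (signedRpow m) :=
  Function.LeftInverse.injective (signedRpow_one_div_signedRpow hm)

theorem signedRpow_eq_max_rpow_sub_max_rpow (hm : m ≠ 0) (x : ℝ) :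
    signedRpow m x = max x 0 ^ m - max (-x) 0 ^ m := by
  rcases le_total 0 x with hx | hx
  · rw [max_eq_left hx, max_eq_right (neg_nonpos.2 hx), Real.zero_rpow hm, sub_zero,
      signedRpow_of_nonneg hm hx]
  · rw [max_eq_right hx, max_eq_left (neg_nonneg.2 hx), Real.zero_rpow hm, zero_sub,
      ← signedRpow_of_nonneg hm (neg_nonneg.2 hx), signedRpow_neg, neg_neg]

theorem locallyLipschitz_signedRpow (hm : 1 ≤ m) : LocallyLipschitz (signedRpow m) := by
  rw [funext (signedRpow_eq_max_rpow_sub_max_rpow (m := m) (by positivity))]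
  exact ((locallyLipschitz_rpow hm).comp (LocallyLipschitz.id.max_const 0)).sub
    ((locallyLipschitz_rpow hm).comp (LocallyLipschitz.id.neg.max_const 0))

end SignedPower

section Model

variable {π₁ π₂ π₃ n p α A : ℝ}

theorem forall_fin_three {P : Fin 3 → Prop} : (∀ i, P i) ↔ P 0 ∧ P 1 ∧ P 2 :=
  Fin.forall_fin_succ.trans (and_congr_right' Fin.forall_fin_two)

theorem stateFunction_apply_zero (x : EuclideanSpace ℝ (Fin 3)) :
    stateFunction π₁ π₂ π₃ n p α A x 0 = x 2 :=
  rfl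

theorem stateFunction_apply_one (x : EuclideanSpace ℝ (Fin 3)) :
    stateFunction π₁ π₂ π₃ n p α A x 1
      = A * (x 2 - π₂ * signedRpow n (x 1) * |x 2| - π₃ * |x 1| ^ n * x 2) := by
  simp only [stateFunction, signedRpow, PiLp.toLp_apply, Matrix.cons_val, mul_assoc]

theorem stateFunction_apply_two (x : EuclideanSpace ℝ (Fin 3)) :
    stateFunction π₁ π₂ π₃ n p α A x 2
      = -(α * signedRpow p (x 0)) - (1 - α) * signedRpow p (x 1) - π₁ * |x 0| ^ p * x 2 := by
  simp only [stateFunction, signedRpow, PiLp.toLp_apply, Matrix.cons_val, mul_assoc]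

theorem locallyLipschitz_stateFunction (π₁ π₂ π₃ α A : ℝ) (hn : 1 ≤ n) (hp : 1 ≤ p) :
    LocallyLipschitz (stateFunction π₁ π₂ π₃ n p α A) := by
  have hcoord : ∀ i, LocallyLipschitz fun x : EuclideanSpace ℝ (Fin 3) => x i := fun i =>
    (EuclideanSpace.proj (𝕜 := ℝ) i).lipschitz.locallyLipschitz
  have hconst_mul : ∀ (c : ℝ) {g : EuclideanSpace ℝ (Fin 3) → ℝ}, LocallyLipschitz g →
      LocallyLipschitz fun x => c * g x := fun c _ hg => locallyLipschitz_mul (.const c) hg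
  have hsigned : ∀ {m : ℝ} (i : Fin 3), 1 ≤ m →
      LocallyLipschitz fun x : EuclideanSpace ℝ (Fin 3) => signedRpow m (x i) := fun i hm =>
    (locallyLipschitz_signedRpow hm).comp (hcoord i)
  have habs : ∀ {m : ℝ} (i : Fin 3), 1 ≤ m →
      LocallyLipschitz fun x : EuclideanSpace ℝ (Fin 3) => |x i| ^ m := fun i hm =>
    (locallyLipschitz_abs_rpow hm).comp (hcoord i)
  refine locallyLipschitz_of_forall_apply (forall_fin_three.2 ⟨?_, ?_, ?_⟩)
  · simpa only [stateFunction_apply_zero] using hcoord 2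
  · simp only [stateFunction_apply_one]
    exact hconst_mul A (((hcoord 2).sub (locallyLipschitz_mul (hconst_mul π₂ (hsigned 1 hn))
      (locallyLipschitz_abs.comp (hcoord 2)))).sub
      (locallyLipschitz_mul (hconst_mul π₃ (habs 1 hn)) (hcoord 2)))
  · simp only [stateFunction_apply_two]
    exact ((hconst_mul α (hsigned 0 hp)).neg.sub (hconst_mul (1 - α) (hsigned 1 hp))).sub
      (locallyLipschitz_mul (hconst_mul π₁ (habs 0 hp)) (hcoord 2))

theorem mem_equilibriumLine_iff {x : EuclideanSpace ℝ (Fin 3)} :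
    x ∈ equilibriumLine p α ↔ x 1 = -(α / (1 - α)) ^ (1 / p) * x 0 ∧ x 2 = 0 := by
  constructor
  · rintro ⟨y, rfl⟩
    exact ⟨rfl, rfl⟩
  · rintro ⟨h1, h2⟩
    exact ⟨x 0, PiLp.ext (forall_fin_three.2 ⟨rfl, h1, h2⟩)⟩

theorem stateFunction_eq_zero_iff {x : EuclideanSpace ℝ (Fin 3)} :
    stateFunction π₁ π₂ π₃ n p α A x = 0
      ↔ x 2 = 0 ∧ stateFunction π₁ π₂ π₃ n p α A x 2 = 0 := by
  refine ⟨fun h => ⟨congrArg (· 0) h, congrArg (· 2) h⟩, fun ⟨h2, hf2⟩ => ?_⟩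
  refine PiLp.ext (forall_fin_three.2 ⟨h2, ?_, hf2⟩)
  rw [stateFunction_apply_one, h2, abs_zero]
  simp only [mul_zero, sub_zero, PiLp.zero_apply]

theorem mem_equilibriumLine_iff_stateFunction_eq_zero (hp : 0 < p) (hα : α ∈ Set.Ioo (0 : ℝ) 1)
    {x : EuclideanSpace ℝ (Fin 3)} :
    x ∈ equilibriumLine p α ↔ stateFunction π₁ π₂ π₃ n p α A x = 0 := by
  have hα' : 0 < 1 - α := sub_pos.2 hα.2
  have hratio : 0 ≤ α / (1 - α) := div_nonneg hα.1.le hα'.le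
  have hslope : signedRpow p ((α / (1 - α)) ^ (1 / p)) = α / (1 - α) := by
    rw [signedRpow_of_nonneg hp.ne' (Real.rpow_nonneg hratio _), ← Real.rpow_mul hratio,
      one_div_mul_cancel hp.ne', Real.rpow_one]
  rw [mem_equilibriumLine_iff, stateFunction_eq_zero_iff, and_comm]
  refine and_congr_right fun h2 => ?_
  rw [← (signedRpow_injective hp.ne').eq_iff, signedRpow_mul, signedRpow_neg, hslope,
    stateFunction_apply_two, h2]
  field_simp
  constructor <;> intro h <;> linarith

/-- The rate `-d𝒱/dt` at which the Lyapunov function decreases along solutions of the model. -/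
noncomputable def dissipation (π₁ π₂ π₃ n p α : ℝ) (x : EuclideanSpace ℝ (Fin 3)) : ℝ :=
  (1 - α) * |x 1| ^ (p - 1) * |x 1| ^ n * (π₂ * |x 1 * x 2| + π₃ * (x 1 * x 2))
    + π₁ * |x 0| ^ p * x 2 ^ 2

theorem continuous_dissipation (π₁ π₂ π₃ α : ℝ) (hn : 0 ≤ n) (hp : 1 ≤ p) :
    Continuous (dissipation π₁ π₂ π₃ n p α) := by
  have hp0 : 0 ≤ p := zero_le_one.trans hp
  have hp1 : 0 ≤ p - 1 := sub_nonneg.2 hp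
  unfold dissipation
  fun_prop

theorem continuous_lyapunov (hp : -1 ≤ p) (α A : ℝ) : Continuous (lyapunov p α A) := by
  have hp1 : 0 ≤ p + 1 := by linarith
  unfold lyapunov
  fun_prop

theorem hysteretic_dissipation_nonneg (hπ₃ : |π₃| ≤ π₂) (hα : α ≤ 1) (z v : ℝ) :
    0 ≤ (1 - α) * |z| ^ (p - 1) * |z| ^ n * (π₂ * |z * v| + π₃ * (z * v)) := by
  have hwork : 0 ≤ π₂ * |z * v| + π₃ * (z * v) := by
    have hbound : |π₃ * (z * v)| ≤ π₂ * |z * v| := by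
      rw [abs_mul]
      gcongr
    linarith [neg_le_of_abs_le hbound]
  have := sub_nonneg.2 hα
  positivity

theorem dissipation_nonneg (hπ₁ : 0 ≤ π₁) (hπ₃ : |π₃| ≤ π₂) (hα : α ≤ 1)
    (x : EuclideanSpace ℝ (Fin 3)) : 0 ≤ dissipation π₁ π₂ π₃ n p α x :=
  add_nonneg (hysteretic_dissipation_nonneg hπ₃ hα _ _) (by positivity)

theorem position_mul_velocity_eq_zero_of_dissipation_eq_zero (hπ₁ : 0 < π₁) (hπ₃ : |π₃| ≤ π₂)
    (hp : p ≠ 0) (hα : α ≤ 1) {x : EuclideanSpace ℝ (Fin 3)}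
    (hx : dissipation π₁ π₂ π₃ n p α x = 0) : x 0 * x 2 = 0 := by
  have hviscous : π₁ * |x 0| ^ p * x 2 ^ 2 = 0 :=
    ((add_eq_zero_iff_of_nonneg (hysteretic_dissipation_nonneg hπ₃ hα (x 1) (x 2))
      (by positivity)).1 hx).2
  simpa only [mul_eq_zero, hπ₁.ne', false_or, Real.rpow_eq_zero (abs_nonneg (x 0)) hp,
    abs_eq_zero, pow_eq_zero_iff two_ne_zero] using hviscous

theorem abs_le_one_add_div_of_mul_abs_rpow_le {y c m L : ℝ} (hc : 0 < c) (hm : 1 ≤ m)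
    (h : c * |y| ^ m ≤ L) : |y| ≤ 1 + L / c := by
  have hle : |y| ^ m ≤ L / c := (le_div_iff₀' hc).2 h
  rcases le_total |y| 1 with hy | hy
  · linarith [Real.rpow_nonneg (abs_nonneg y) m]
  · linarith [Real.self_le_rpow_of_one_le hy hm]

theorem isCompact_sublevelSet (hp : 0 ≤ p) (hα : α ∈ Set.Ioo (0 : ℝ) 1) (hA : 0 < A)
    (y : EuclideanSpace ℝ (Fin 3)) : IsCompact (sublevelSet p α A y) := by
  have hα0 : 0 < α := hα.1
  have hα' : 0 < 1 - α := sub_pos.2 hα.2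
  set L := lyapunov p α A y
  set r : Fin 3 → ℝ :=
    ![1 + L / (1 / (p + 1) * α), 1 + L / (1 / (p + 1) * ((1 - α) / A)), 1 + L / (1 / 2)]
  have hbox : Bornology.IsBounded
      (WithLp.ofLp ⁻¹' Set.univ.pi (fun i => Metric.closedBall (0 : ℝ) (r i)) :
        Set (EuclideanSpace ℝ (Fin 3))) :=
    (PiLp.antilipschitzWith_ofLp 2 fun _ : Fin 3 => ℝ).isBounded_preimage
      (Bornology.IsBounded.pi fun _ => Metric.isBounded_closedBall)
  refine Metric.isCompact_of_isClosed_isBounded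
    (isClosed_le (continuous_lyapunov (by linarith) α A) continuous_const)
    (hbox.subset fun x (hx : lyapunov p α A x ≤ L) => ?_)
  have hX : 0 ≤ 1 / (p + 1) * α * |x 0| ^ (p + 1) := by positivity
  have hZ : 0 ≤ 1 / (p + 1) * ((1 - α) / A) * |x 1| ^ (p + 1) := by positivity
  have hV : 0 ≤ 1 / 2 * x 2 ^ 2 := by positivity
  unfold lyapunov at hx
  refine Set.mem_univ_pi.2 fun i => mem_closedBall_zero_iff.2 ?_
  revert i
  refine forall_fin_three.2 ⟨?_, ?_, ?_⟩
  · exact abs_le_one_add_div_of_mul_abs_rpow_le (m := p + 1) (by positivity) (by linarith)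
      (by linarith)
  · exact abs_le_one_add_div_of_mul_abs_rpow_le (m := p + 1) (by positivity) (by linarith)
      (by linarith)
  · refine abs_le_one_add_div_of_mul_abs_rpow_le (m := 2) (by positivity) one_le_two ?_
    rw [Real.rpow_two, sq_abs]
    linarith

section Trajectory

variable {X : ℝ → EuclideanSpace ℝ (Fin 3)} {I : Set ℝ} {K : Set (EuclideanSpace ℝ (Fin 3))}

theorem IsSolutionOn.hasDerivWithinAt_abs_apply_rpow {d : ℕ}
    {f : EuclideanSpace ℝ (Fin d) → EuclideanSpace ℝ (Fin d)} {x : ℝ → EuclideanSpace ℝ (Fin d)}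
    (hx : IsSolutionOn f I x) (hp : 0 < p) (i : Fin d) {t : ℝ} (ht : t ∈ I) :
    HasDerivWithinAt (fun s => |x s i| ^ (p + 1)) ((p + 1) * signedRpow p (x t i) * f (x t) i)
      I t := by
  have h := (hasDerivAt_abs_rpow (x t i) (by linarith : 1 < p + 1)).comp_hasDerivWithinAt t
    (hx.hasDerivWithinAt_apply i ht)
  rwa [show p + 1 - 2 = p - 1 by ring, mul_assoc (p + 1)] at h

theorem IsSolutionOn.hasDerivWithinAt_lyapunov (hn : n ≠ 0) (hp : 0 < p) (hA : A ≠ 0)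
    (hX : IsSolutionOn (stateFunction π₁ π₂ π₃ n p α A) I X) {t : ℝ} (ht : t ∈ I) :
    HasDerivWithinAt (fun s => lyapunov p α A (X s)) (-dissipation π₁ π₂ π₃ n p α (X t)) I t := by
  refine ((((hX.hasDerivWithinAt_abs_apply_rpow hp 0 ht).const_mul (1 / (p + 1) * α)).add
    ((hX.hasDerivWithinAt_abs_apply_rpow hp 1 ht).const_mul (1 / (p + 1) * ((1 - α) / A)))).add
    (((hX.hasDerivWithinAt_apply 2 ht).pow 2).const_mul (1 / 2))).congr_deriv ?_
  have hZ : signedRpow n (X t 1) * X t 1 = |X t 1| ^ n * |X t 1| := by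
    rw [signedRpow, mul_assoc, ← abs_mul_abs_self, ← mul_assoc, abs_rpow_sub_one_mul_abs hn]
  rw [stateFunction_apply_zero, stateFunction_apply_one, stateFunction_apply_two, dissipation,
    abs_mul, signedRpow.eq_1 p (X t 1)]
  field_simp
  linear_combination (-2 * (1 - α) * |X t 1| ^ (p - 1) * π₂ * |X t 2|) * hZ

theorem IsSolutionOn.antitoneOn_lyapunov (hI : Convex ℝ I) (hπ₁ : 0 ≤ π₁) (hπ₃ : |π₃| ≤ π₂)
    (hn : n ≠ 0) (hp : 0 < p) (hα : α ≤ 1) (hA : A ≠ 0)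
    (hX : IsSolutionOn (stateFunction π₁ π₂ π₃ n p α A) I X) :
    AntitoneOn (fun t => lyapunov p α A (X t)) I :=
  antitoneOn_of_hasDerivWithinAt_nonpos hI
    ((continuous_lyapunov (by linarith) α A).comp_continuousOn hX.continuousOn)
    (fun _ ht => (hX.hasDerivWithinAt_lyapunov hn hp hA (interior_subset ht)).mono interior_subset)
    (fun _ _ => neg_nonpos.2 (dissipation_nonneg hπ₁ hπ₃ hα _))

theorem IsSolutionOn.stateFunction_eq_zero_of_mapClusterPt (hπ₁ : 0 < π₁) (hπ₃ : |π₃| ≤ π₂)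
    (hn : 1 ≤ n) (hp : 1 ≤ p) (hα : α ≤ 1) (hA : A ≠ 0) (hK : IsCompact K)
    (hXK : Set.MapsTo X (Set.Ici 0) K)
    (hX : IsSolutionOn (stateFunction π₁ π₂ π₃ n p α A) (Set.Ici 0) X)
    {q : EuclideanSpace ℝ (Fin 3)} (hq : MapClusterPt q atTop X) :
    stateFunction π₁ π₂ π₃ n p α A q = 0 := by
  have hf : Continuous (stateFunction π₁ π₂ π₃ n p α A) :=
    (locallyLipschitz_stateFunction π₁ π₂ π₃ α A hn hp).continuous
  have hf2 : Continuous fun y => stateFunction π₁ π₂ π₃ n p α A y 2 :=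
    (EuclideanSpace.proj (𝕜 := ℝ) 2).continuous.comp hf
  have hn0 : n ≠ 0 := by positivity
  have hp0 : 0 < p := by positivity
  have hXunif : UniformContinuousOn X (Set.Ici 0) :=
    hX.uniformContinuousOn (convex_Ici 0) hf.continuousOn hK hXK
  have hXV : ∀ q, MapClusterPt q atTop X → q 0 * q 2 = 0 := fun q hq =>
    position_mul_velocity_eq_zero_of_dissipation_eq_zero hπ₁ hπ₃ hp0.ne' hα <|
      dissipation_eq_zero_of_mapClusterPt hK hXK hXunif (continuous_lyapunov (by linarith) α A)
        (continuous_dissipation π₁ π₂ π₃ α (by linarith) hp)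
        (hX.antitoneOn_lyapunov (convex_Ici 0) hπ₁.le hπ₃ hn0 hp0 hα hA)
        (fun _ ht => hX.hasDerivWithinAt_lyapunov hn0 hp0 hA ht) hq
  have hV : ∀ q, MapClusterPt q atTop X → q 2 = 0 := fun q hq =>
    velocity_eq_zero_of_forall_position_mul_velocity_eq_zero hK hXK hXunif
      (u := fun y => y 0) (v := fun y => y 2)
      (w := fun y => stateFunction π₁ π₂ π₃ n p α A y 2) (by fun_prop) (by fun_prop) hf2
      (fun _ ht => hX.hasDerivWithinAt_apply 0 ht) (fun _ ht => hX.hasDerivWithinAt_apply 2 ht)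
      hXV hq
  have hVdot : stateFunction π₁ π₂ π₃ n p α A q 2 = 0 :=
    eq_zero_of_mapClusterPt_of_forall_eq_of_hasDerivWithinAt hK hXK hXunif (Φ := fun y => y 2)
      (F := fun y => stateFunction π₁ π₂ π₃ n p α A y 2) (by fun_prop) hf2
      (fun _ ht => hX.hasDerivWithinAt_apply 2 ht) hV hq
  exact stateFunction_eq_zero_iff.2 ⟨hV q hq, hVdot⟩

end Trajectory

end Model

end BoucWen

theorem mainTheorem2_general (π₁ π₂ π₃ n p α A : ℝ)
    (hπ₁ : 0 < π₁) (hπ₃ : |π₃| ≤ π₂)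
    (hn : 1 ≤ n) (hp : 1 ≤ p) (hα : α ∈ Set.Ioo (0 : ℝ) 1) (hA : 0 < A)
    (X : ℝ → EuclideanSpace ℝ (Fin 3)) (Y : EuclideanSpace ℝ (Fin 3))
    (hX : BoucWen.IsSolutionOn (BoucWen.stateFunction π₁ π₂ π₃ n p α A) (Set.Ici 0) X)
    (hX0 : X 0 = Y) :
    (BoucWen.positiveLimitSet X).Nonempty ∧
    IsConnected (BoucWen.positiveLimitSet X) ∧
    BoucWen.IsInvariantSet (BoucWen.stateFunction π₁ π₂ π₃ n p α A)
      (BoucWen.positiveLimitSet X) ∧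
    BoucWen.ConvergesToSet X (BoucWen.positiveLimitSet X) ∧
    BoucWen.positiveLimitSet X ⊆
      BoucWen.sublevelSet p α A Y ∩ BoucWen.equilibriumLine p α := by
  subst hX0
  have hp0 : 0 < p := by positivity
  have hK := BoucWen.isCompact_sublevelSet hp0.le hα hA (X 0)
  have hXK : Set.MapsTo X (Set.Ici 0) (BoucWen.sublevelSet p α A (X 0)) := fun t ht =>
    hX.antitoneOn_lyapunov (convex_Ici 0) hπ₁.le hπ₃ (by positivity) hp0 hα.2.le hA.ne'
      Set.self_mem_Ici ht ht
  have hXK' : ∀ᶠ t in atTop, X t ∈ BoucWen.sublevelSet p α A (X 0) :=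
    (eventually_ge_atTop 0).mono fun t ht => hXK ht
  have hconn := BoucWen.isConnected_positiveLimitSet hX.continuousOn hK hXK'
  have hzero : ∀ q ∈ BoucWen.positiveLimitSet X, BoucWen.stateFunction π₁ π₂ π₃ n p α A q = 0 :=
    fun q hq => hX.stateFunction_eq_zero_of_mapClusterPt hπ₁ hπ₃ hn hp hα.2.le hA.ne' hK hXK
      (BoucWen.mem_positiveLimitSet_iff_mapClusterPt.1 hq)
  exact ⟨hconn.nonempty, hconn,
    BoucWen.isInvariantSet_of_forall_eq_zero
      (BoucWen.locallyLipschitz_stateFunction π₁ π₂ π₃ α A hn hp) hzero,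
    BoucWen.convergesToSet_positiveLimitSet hK hXK',
    fun q hq => ⟨hK.isClosed.mem_of_mapClusterPt
        (BoucWen.mem_positiveLimitSet_iff_mapClusterPt.1 hq) hXK',
      (BoucWen.mem_equilibriumLine_iff_stateFunction_eq_zero hp0 hα).2 (hzero q hq)⟩⟩

theorem mainTheorem2 (π₁ π₂ π₃ n p α A : ℝ)
    (hπ₁ : 0 < π₁) (hπ₂ : 0 < π₂) (hπ₃ : π₃ ∈ Set.Ioo (-π₂) π₂)
    (hn : 1 ≤ n) (hp : 1 ≤ p) (hα : α ∈ Set.Ioo (0 : ℝ) 1) (hA : 0 < A)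
    (X : ℝ → EuclideanSpace ℝ (Fin 3)) (Y : EuclideanSpace ℝ (Fin 3))
    (hX : BoucWen.IsSolutionOn (BoucWen.stateFunction π₁ π₂ π₃ n p α A) (Set.Ici 0) X)
    (hX0 : X 0 = Y) :
    (BoucWen.positiveLimitSet X).Nonempty ∧
    IsConnected (BoucWen.positiveLimitSet X) ∧
    BoucWen.IsInvariantSet (BoucWen.stateFunction π₁ π₂ π₃ n p α A)
      (BoucWen.positiveLimitSet X) ∧
    BoucWen.ConvergesToSet X (BoucWen.positiveLimitSet X) ∧
    BoucWen.positiveLimitSet X ⊆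
      BoucWen.sublevelSet p α A Y ∩ BoucWen.equilibriumLine p α :=
  mainTheorem2_general π₁ π₂ π₃ n p α A hπ₁ (abs_le.2 ⟨hπ₃.1.le, hπ₃.2.le⟩) hn hp hα hA X Y hX hX0
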